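/- For $n\ge 0$ let $\mathfrak{D}_n$ be the set of derangements (fixed-point-free permutations) of $\{1,\dots,n\}$. For a permutation $\sigma$ of $\{1,\dots,n\}$ let $\mathrm{wex}(\sigma)$ be the number of $i$ with $\sigma(i)\ge i$, and let $\mathrm{cr}(\sigma)$ be the number of pairs $(i,j)$ such that either $i<j\le\sigma(i)<\sigma(j)$ or $\sigma(i)<\sigma(j)<i<j$. Let $[h]_q=1+q+\dots+q^{h-1}$, which is $\frac{1-q^h}{1-q}$ for $q\neq 1$, and define the $q$-secant numbers $E_{2k}(q)$ by the expansion, as a formal power series in $x$, \[ \sum_{k\ge 0}E_{2k}(q)\,x^k=\cfrac{1}{1-\cfrac{[1]_q^2\,x}{1-\cfrac{[2]_q^2\,x}{1-\cfrac{[3]_q^2\,x}{\ddots}}}} . \] Let $q$ be a nonzero element of a field (for instance the indeterminate $q$ in $\mathbb{Q}(q)$). Then for every $n\ge 0$ \[ \sum_{\sigma\in\mathfrak{D}_n}\left(-\tfrac1q\right)^{\mathrm{wex}(\sigma)}q^{\mathrm{cr}(\sigma)}= \begin{cases}\left(-\tfrac1q\right)^{n/2}E_n(q)&\text{if } n \text{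 is even},\\ 0&\text{if } n\text{ is odd.}\end{cases} \] -/

import Mathlib

open scoped PowerSeries

/-- Number of weak exceedances of `σ`: positions `i` with `i ≤ σ i`. -/
def wex {n : ℕ} (σ : Equiv.Perm (Fin n)) : ℕ :=
  (Finset.univ.filter fun i : Fin n => i ≤ σ i).card

/-- Number of crossings of `σ`: pairs `(i, j)` such that
`i < j ≤ σ i < σ j` or `σ i < σ j < i < j`. -/
def cr {n : ℕ} (σ : Equiv.Perm (Fin n)) : ℕ :=
  (Finset.univ.filter fun p : Fin n × Fin n =>
    (p.1 < p.2 ∧ p.2 ≤ σ p.1 ∧ σ p.1 < σ p.2) ∨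
    (σ p.1 < σ p.2 ∧ σ p.2 < p.1 ∧ p.1 < p.2)).card

/-- The `q`-integer `[h]_q = 1 + q + ⋯ + q ^ (h - 1)`, equal to `(1 - q ^ h) / (1 - q)`
when `q ≠ 1`. -/
def qInt {K : Type*} [Field K] (q : K) (h : ℕ) : K :=
  ∑ i ∈ Finset.range h, q ^ i

theorem qInt_eq_div {K : Type*} [Field K] (q : K) (hq : q ≠ 1) (h : ℕ) :
    qInt q h = (1 - q ^ h) / (1 - q) := by
  rw [eq_div_iff (sub_ne_zero.mpr hq.symm)]
  exact geom_sum_mul_neg q h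

/-- The finite truncation, with `m` levels, of the tail starting at index `h` of the
continued fraction `1 / (1 - c 0 x / (1 - c 1 x / (1 - c 2 x / ⋯)))`, namely
`1 / (1 - c h x / (1 - ⋯ / (1 - c (h + m - 1) x)))`, as a formal power series in `x`. -/
noncomputable def contFracTrunc {K : Type*} [Field K] (c : ℕ → K) : ℕ → ℕ → K⟦X⟧
  | 0, _ => 1
  | m + 1, h =>
      (1 - PowerSeries.C (c h) * PowerSeries.X * contFracTrunc c m (h + 1))⁻¹

/-- The formal power series given by the infinite continued fraction
`1 / (1 - c 0 x / (1 - c 1 x / (1 - c 2 x / ⋯)))`, the coefficientwise limit of its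
truncations: the coefficient of `x ^ n` is the same in all truncations with at least `n` levels
(see `coeff_contFracTrunc_eq`). -/
noncomputable def contFrac {K : Type*} [Field K] (c : ℕ → K) : K⟦X⟧ :=
  PowerSeries.mk fun n => PowerSeries.coeff n (contFracTrunc c n 0)

theorem X_pow_dvd_contFracTrunc_sub {K : Type*} [Field K] (c : ℕ → K) (n : ℕ) :
    ∀ (m h : ℕ), n ≤ m →
      (PowerSeries.X : K⟦X⟧) ^ (n + 1) ∣ contFracTrunc c m h - contFracTrunc c n h := by
  have key : ∀ (m h : ℕ), (1 - PowerSeries.C (c h) * PowerSeries.X * contFracTrunc c m (h + 1)) *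
      (1 - PowerSeries.C (c h) * PowerSeries.X * contFracTrunc c m (h + 1))⁻¹ = 1 := by
    intro m h
    apply PowerSeries.mul_inv_cancel
    simp
  induction n with
  | zero =>
    intro m h _
    cases m with
    | zero => simp
    | succ m =>
      have h1 := key m h
      simp only [contFracTrunc]
      set b := (1 - PowerSeries.C (c h) * PowerSeries.X * contFracTrunc c m (h + 1))⁻¹
      exact ⟨PowerSeries.C (c h) * contFracTrunc c m (h + 1) * b, by linear_combination h1⟩
  | succ n ih =>
    intro m h hm
    cases m with
    | zero => omega
    | succ m =>
      obtain ⟨d, hd⟩ := ih m (h + 1) (by omega)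
      have h1 := key m h
      have h2 := key n h
      simp only [contFracTrunc]
      set s := contFracTrunc c m (h + 1)
      set t := contFracTrunc c n (h + 1)
      set a := (1 - PowerSeries.C (c h) * PowerSeries.X * s)⁻¹
      set b := (1 - PowerSeries.C (c h) * PowerSeries.X * t)⁻¹
      refine ⟨PowerSeries.C (c h) * d * a * b, ?_⟩
      linear_combination b * h1 - a * h2 + PowerSeries.C (c h) * PowerSeries.X * a * b * hd

theorem coeff_contFracTrunc_eq {K : Type*} [Field K] (c : ℕ → K) (n m : ℕ) (h : n ≤ m) :
    PowerSeries.coeff n (contFracTrunc c m 0) = PowerSeries.coeff n (contFrac c) := by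
  have := (PowerSeries.X_pow_dvd_iff.mp (X_pow_dvd_contFracTrunc_sub c n m 0 h)) n (by omega)
  rw [map_sub, sub_eq_zero] at this
  rw [this, contFrac, PowerSeries.coeff_mk]

/-- The `q`-secant number `E_{2k}(q)`: the coefficient of `x ^ k` in
`1 / (1 - [1]_q ^ 2 x / (1 - [2]_q ^ 2 x / (1 - [3]_q ^ 2 x / ⋯)))`. -/
noncomputable def qSecant {K : Type*} [Field K] (q : K) (k : ℕ) : K :=
  PowerSeries.coeff k (contFrac fun h => qInt q (h + 1) ^ 2)

/-! Read the permutation matrix of a derangement one index at a time, adding row `m` and then column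
`m` to a partial rook placement off the diagonal. If `h` rows and `h` columns are free, leaving both
new lines empty leads to `h + 1`. Filling only the row contributes `[h]_q`, filling only the column
contributes `y * q * [h]_q`, and both keep `h`; filling both contributes `y * [h]_q ^ 2` and leads
to `h - 1`. A crossing is charged to the arc completed first, so later rooks never change earlier
weights.

For `y = -1/q` the level steps cancel (`placementSum_succ`), leaving weighted Dyck paths. These
vanish for odd length, and for even length the continued fraction enumerates them
(`dyckStep_iterate_eq`). Full placements are exactly the graphs of derangements
(`placementSum_atZero`). -/

/-! ### Functional equations for continued fraction tails -/

/-- The tail starting at index `h` of the continued fraction with coefficients `c`. -/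
noncomputable def contFracTail {K : Type*} [Field K] (c : ℕ → K) (h : ℕ) : K⟦X⟧ :=
  PowerSeries.mk fun n => PowerSeries.coeff n (contFracTrunc c n h)

theorem X_pow_dvd_contFracTail_sub {K : Type*} [Field K] (c : ℕ → K) (n h : ℕ) :
    (PowerSeries.X : K⟦X⟧) ^ (n + 1) ∣ contFracTail c h - contFracTrunc c n h := by
  rw [PowerSeries.X_pow_dvd_iff]
  intro k hk
  have := PowerSeries.X_pow_dvd_iff.mp
    (X_pow_dvd_contFracTrunc_sub c k n h (by omega)) k (by omega)
  rw [map_sub, sub_eq_zero] at this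
  rw [map_sub, contFracTail, PowerSeries.coeff_mk, this, sub_self]

theorem contFracTail_eq {K : Type*} [Field K] (c : ℕ → K) (h : ℕ) :
    contFracTail c h =
      1 + PowerSeries.C (c h) * PowerSeries.X * (contFracTail c h * contFracTail c (h + 1)) := by
  rw [← sub_eq_zero]
  ext n
  rw [map_zero]
  refine PowerSeries.X_pow_dvd_iff.mp ?_ n n.lt_add_one
  obtain ⟨d, hd⟩ := X_pow_dvd_contFracTail_sub c n (h + 1)
  -- One more level is needed at `h` than at `h + 1` for the truncations to satisfy an exact
  -- recursion; the extra power of `X` is dropped.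
  obtain ⟨e, he⟩ := (pow_dvd_pow (PowerSeries.X : K⟦X⟧) (Nat.le_succ (n + 1))).trans
    (X_pow_dvd_contFracTail_sub c (n + 1) h)
  have key : (1 - PowerSeries.C (c h) * PowerSeries.X * contFracTrunc c n (h + 1)) *
      contFracTrunc c (n + 1) h = 1 := by
    rw [contFracTrunc]
    apply PowerSeries.mul_inv_cancel
    simp
  set F := contFracTail c h
  set G := contFracTail c (h + 1)
  set s := contFracTrunc c n (h + 1)
  set t := contFracTrunc c (n + 1) h
  refine ⟨e * (1 - PowerSeries.C (c h) * PowerSeries.X * G) -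
    PowerSeries.C (c h) * PowerSeries.X * t * d, ?_⟩
  linear_combination (1 - PowerSeries.C (c h) * PowerSeries.X * G) * he
    - PowerSeries.C (c h) * PowerSeries.X * t * hd + key

/-- The generating function of weighted Dyck paths from height `h` down to `0`, with
variable marking the up steps. -/
noncomputable def tailProd {K : Type*} [Field K] (c : ℕ → K) : ℕ → K⟦X⟧
  | 0 => contFracTail c 0
  | h + 1 => PowerSeries.C (c h) * tailProd c h * contFracTail c (h + 1)

theorem tailProd_zero_eq {K : Type*} [Field K] (c : ℕ → K) :
    tailProd c 0 = 1 + PowerSeries.X * tailProd c 1 := by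
  simp only [tailProd]
  linear_combination contFracTail_eq c 0

theorem tailProd_succ_eq {K : Type*} [Field K] (c : ℕ → K) (h : ℕ) :
    tailProd c (h + 1) =
      PowerSeries.C (c h) * tailProd c h + PowerSeries.X * tailProd c (h + 2) := by
  simp only [tailProd]
  linear_combination (PowerSeries.C (c h) * tailProd c h) * contFracTail_eq c (h + 1)

/-! ### Weighted Dyck paths -/

/-- The transfer operator of weighted Dyck paths: an up step has weight `1` and a down step from
height `h` has weight `y * [h]_q ^ 2`. -/
def dyckStep {K : Type*} [Field K] (y q : K) (g : ℕ → K) (h : ℕ) : K :=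
  g (h + 1) + y * qInt q h ^ 2 * g (h - 1)

/-- The indicator function of height `0`. -/
def atZero (K : Type*) [Field K] (h : ℕ) : K := if h = 0 then 1 else 0

/-- `[0]_q = 0` kills the down step, so the truncated value `0 - 1 = 0` is harmless. -/
theorem dyckStep_zero {K : Type*} [Field K] (y q : K) (g : ℕ → K) :
    dyckStep y q g 0 = g 1 := by
  simp [dyckStep, qInt]

theorem dyckStep_iterate_of_lt {K : Type*} [Field K] (y q : K) (n : ℕ) :
    ∀ h, n < h → (dyckStep y q)^[n] (atZero K) h = 0 := by
  induction n with
  | zero => intro h hh; simp [atZero, hh.ne']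
  | succ n ih =>
    intro h hh
    rw [Function.iterate_succ_apply', dyckStep, ih _ (by omega), ih _ (by omega)]
    simp

theorem dyckStep_iterate_of_odd {K : Type*} [Field K] (y q : K) (n : ℕ) :
    ∀ h, Odd (n + h) → (dyckStep y q)^[n] (atZero K) h = 0 := by
  induction n with
  | zero =>
    intro h hh
    have : h ≠ 0 := by rintro rfl; simp at hh
    simp [atZero, this]
  | succ n ih =>
    rintro (_ | h) hh
    · rw [Function.iterate_succ_apply', dyckStep_zero, ih _ hh]
    · rw [Function.iterate_succ_apply', dyckStep, ih _ (by grind), ih _ (by grind)]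
      simp

/-- A path from height `h` to `0` with `k` up steps has `h + k` down steps, each carrying a factor
`y`. Both sides obey the same first-step recursion, by `tailProd_zero_eq` and `tailProd_succ_eq`. -/
theorem dyckStep_iterate_eq {K : Type*} [Field K] (y q : K) (n : ℕ) :
    ∀ h k, n = h + 2 * k → (dyckStep y q)^[n] (atZero K) h =
      y ^ (h + k) * PowerSeries.coeff k (tailProd (fun i => qInt q (i + 1) ^ 2) h) := by
  induction n with
  | zero =>
    intro h k hn
    obtain rfl : h = 0 := by omega
    obtain rfl : k = 0 := by omega
    rw [tailProd_zero_eq]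
    simp [atZero]
  | succ n ih =>
    rintro (_ | h) (_ | k) hn
    · omega
    · rw [Function.iterate_succ_apply', dyckStep_zero, ih 1 k (by omega), tailProd_zero_eq,
        map_add, PowerSeries.coeff_succ_X_mul, PowerSeries.coeff_one]
      simp [add_comm]
    · rw [Function.iterate_succ_apply', dyckStep, dyckStep_iterate_of_lt _ _ _ _ (by omega),
        Nat.add_sub_cancel, ih h 0 (by omega), tailProd_succ_eq, map_add,
        PowerSeries.coeff_C_mul, PowerSeries.coeff_zero_X_mul]
      ring
    · rw [Function.iterate_succ_apply', dyckStep, Nat.add_sub_cancel, ih (h + 1 + 1) k (by omega),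
        ih h (k + 1) (by omega), tailProd_succ_eq _ h, map_add, PowerSeries.coeff_C_mul,
        PowerSeries.coeff_succ_X_mul]
      ring

theorem dyckStep_iterate_zero {K : Type*} [Field K] (y q : K) (n : ℕ) :
    (dyckStep y q)^[n] (atZero K) 0 =
      if Even n then y ^ (n / 2) * qSecant q (n / 2) else 0 := by
  split_ifs with hn
  · rw [dyckStep_iterate_eq y q n 0 (n / 2) (by grind), zero_add]
    rfl
  · exact dyckStep_iterate_of_odd y q n 0 (by simpa using hn)

/-! ### Partial rook placements -/

open Finset in
/-- The placements of non-attacking rooks on the off-diagonal cells of the board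
`range a ×ˢ range b`. They encode the partial injections without fixed points. -/
def rookPlacements (a b : ℕ) : Finset (Finset (ℕ × ℕ)) :=
  (range a ×ˢ range b).powerset.filter fun p =>
    ∀ x ∈ p, x.1 ≠ x.2 ∧ ∀ z ∈ p, (x.1 = z.1 ∨ x.2 = z.2) → x = z

/-- The rows below `a` without a rook. -/
def freeRows (a : ℕ) (p : Finset (ℕ × ℕ)) : Finset ℕ := Finset.range a \ p.image Prod.fst

/-- The columns below `b` without a rook. -/
def freeCols (b : ℕ) (p : Finset (ℕ × ℕ)) : Finset ℕ := Finset.range b \ p.image Prod.snd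

theorem mem_freeRows {a i : ℕ} {p : Finset (ℕ × ℕ)} :
    i ∈ freeRows a p ↔ i < a ∧ ∀ v, (i, v) ∉ p := by
  simp [freeRows]

theorem mem_freeCols {b v : ℕ} {p : Finset (ℕ × ℕ)} :
    v ∈ freeCols b p ↔ v < b ∧ ∀ i, (i, v) ∉ p := by
  simp [freeCols]

theorem mem_rookPlacements {a b : ℕ} {p : Finset (ℕ × ℕ)} :
    p ∈ rookPlacements a b ↔ (∀ i v, (i, v) ∈ p → i < a ∧ v < b ∧ i ≠ v) ∧
      (∀ i v w, (i, v) ∈ p → (i, w) ∈ p → v = w) ∧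
      (∀ i j v, (i, v) ∈ p → (j, v) ∈ p → i = j) := by
  simp only [rookPlacements, Finset.mem_filter, Finset.mem_powerset, Finset.subset_iff,
    Finset.mem_product, Finset.mem_range, Prod.forall, Prod.mk.injEq]
  grind

theorem card_freeRows {a b : ℕ} {p : Finset (ℕ × ℕ)} (hp : p ∈ rookPlacements a b) :
    (freeRows a p).card + p.card = a := by
  rw [mem_rookPlacements] at hp
  obtain ⟨h1, h2, h3⟩ := hp
  have hsub : p.image Prod.fst ⊆ Finset.range a := by
    intro i hi
    obtain ⟨⟨j, v⟩, hx, rfl⟩ := Finset.mem_image.mp hi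
    exact Finset.mem_range.mpr (h1 j v hx).1
  have hinj : Set.InjOn Prod.fst (p : Set (ℕ × ℕ)) := by
    rintro ⟨i, v⟩ hx ⟨j, w⟩ hz (rfl : i = j)
    rw [h2 i v w hx hz]
  rw [← Finset.card_image_of_injOn hinj, freeRows, Finset.card_sdiff_add_card_eq_card hsub,
    Finset.card_range]

theorem card_freeCols {a b : ℕ} {p : Finset (ℕ × ℕ)} (hp : p ∈ rookPlacements a b) :
    (freeCols b p).card + p.card = b := by
  rw [mem_rookPlacements] at hp
  obtain ⟨h1, h2, h3⟩ := hp
  have hsub : p.image Prod.snd ⊆ Finset.range b := by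
    intro i hi
    obtain ⟨⟨j, v⟩, hx, rfl⟩ := Finset.mem_image.mp hi
    exact Finset.mem_range.mpr (h1 j v hx).2.1
  have hinj : Set.InjOn Prod.snd (p : Set (ℕ × ℕ)) := by
    rintro ⟨i, v⟩ hx ⟨j, w⟩ hz (rfl : v = w)
    rw [h3 i j v hx hz]
  rw [← Finset.card_image_of_injOn hinj, freeCols, Finset.card_sdiff_add_card_eq_card hsub,
    Finset.card_range]

/-- Summation over placements on a board with one more row: either the new row is empty, or it
holds a rook in a free column. -/
theorem sum_rookPlacements_succ_left {M : Type*} [AddCommMonoid M] (a b : ℕ)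
    (f : Finset (ℕ × ℕ) → M) :
    ∑ p ∈ rookPlacements (a + 1) b, f p =
      ∑ p ∈ rookPlacements a b,
        (f p + ∑ v ∈ (freeCols b p).erase a, f (insert (a, v) p)) := by
  classical
  rw [Finset.sum_add_distrib, Finset.sum_sigma',
    ← Finset.sum_filter_add_sum_filter_not _ (fun p => ∀ v, (a, v) ∉ p)]
  congr 1
  · refine Finset.sum_congr ?_ fun _ _ => rfl
    ext p
    simp only [Finset.mem_filter, mem_rookPlacements]
    grind
  · symm
    refine Finset.sum_bij (fun x _ => insert (a, x.2) x.1) ?_ ?_ ?_ fun _ _ => rfl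
    · rintro ⟨p, v⟩ hx
      simp only [Finset.mem_sigma, Finset.mem_erase, mem_freeCols, mem_rookPlacements,
        Finset.mem_filter, Finset.mem_insert, Prod.mk.injEq] at hx ⊢
      grind
    · rintro ⟨p, v⟩ hx ⟨p', v'⟩ hx' h
      simp only [Finset.mem_sigma, Finset.mem_erase, mem_freeCols, mem_rookPlacements] at hx hx'
      have hn : ∀ w, (a, w) ∉ p := fun w hw => by grind
      have hn' : ∀ w, (a, w) ∉ p' := fun w hw => by grind
      have hv : v = v' := by
        have : (a, v) ∈ insert (a, v') p' := h ▸ Finset.mem_insert_self _ _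
        grind
      subst hv
      have : p = p' := by
        rw [← Finset.erase_insert (hn v), ← Finset.erase_insert (hn' v)]
        exact congrArg (fun s => s.erase (a, v)) h
      subst this
      rfl
    · intro p hp
      simp only [Finset.mem_filter, mem_rookPlacements, not_forall, not_not] at hp
      obtain ⟨hp, v, hv⟩ := hp
      refine ⟨⟨p.erase (a, v), v⟩, ?_, Finset.insert_erase hv⟩
      simp only [Finset.mem_sigma, Finset.mem_erase, mem_freeCols, mem_rookPlacements, ne_eq,
        Prod.mk.injEq]
      grind

/-- Summation over placements on a board with one more column: either the new column is empty, or
it holds a rook in a free row. -/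
theorem sum_rookPlacements_succ_right {M : Type*} [AddCommMonoid M] (a b : ℕ)
    (f : Finset (ℕ × ℕ) → M) :
    ∑ p ∈ rookPlacements a (b + 1), f p =
      ∑ p ∈ rookPlacements a b,
        (f p + ∑ i ∈ (freeRows a p).erase b, f (insert (i, b) p)) := by
  classical
  rw [Finset.sum_add_distrib, Finset.sum_sigma',
    ← Finset.sum_filter_add_sum_filter_not _ (fun p => ∀ i, (i, b) ∉ p)]
  congr 1
  · refine Finset.sum_congr ?_ fun _ _ => rfl
    ext p
    simp only [Finset.mem_filter, mem_rookPlacements]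
    grind
  · symm
    refine Finset.sum_bij (fun x _ => insert (x.2, b) x.1) ?_ ?_ ?_ fun _ _ => rfl
    · rintro ⟨p, i⟩ hx
      simp only [Finset.mem_sigma, Finset.mem_erase, mem_freeRows, mem_rookPlacements,
        Finset.mem_filter, Finset.mem_insert, Prod.mk.injEq] at hx ⊢
      grind
    · rintro ⟨p, i⟩ hx ⟨p', i'⟩ hx' h
      simp only [Finset.mem_sigma, Finset.mem_erase, mem_freeRows, mem_rookPlacements] at hx hx'
      have hn : ∀ j, (j, b) ∉ p := fun w hw => by grind
      have hn' : ∀ j, (j, b) ∉ p' := fun w hw => by grind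
      have hv : i = i' := by
        have : (i, b) ∈ insert (i', b) p' := h ▸ Finset.mem_insert_self _ _
        grind
      subst hv
      have : p = p' := by
        rw [← Finset.erase_insert (hn i), ← Finset.erase_insert (hn' i)]
        exact congrArg (fun s => s.erase (i, b)) h
      subst this
      rfl
    · intro p hp
      simp only [Finset.mem_filter, mem_rookPlacements, not_forall, not_not] at hp
      obtain ⟨hp, i, hi⟩ := hp
      refine ⟨⟨p.erase (i, b), i⟩, ?_, Finset.insert_erase hi⟩
      simp only [Finset.mem_sigma, Finset.mem_erase, mem_freeRows, mem_rookPlacements, ne_eq,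
        Prod.mk.injEq]
      grind

/-! ### Weights and the transfer recursion -/

/-- The contribution of the rook `x` to the weight of the placement `p`: a rook above the diagonal
is marked by `y`, and `q` marks the crossings in which `x` is the arc that is completed first. -/
def rookWeight {K : Type*} [Field K] (y q : K) (p : Finset (ℕ × ℕ)) (x : ℕ × ℕ) : K :=
  if x.1 < x.2 then
    y * q ^ ((Finset.Ioc x.1 x.2).filter fun j => ∀ w ≤ x.2, (j, w) ∉ p).card
  else q ^ ((Finset.Ioo x.2 x.1).filter fun w => ∀ j ≤ x.1, (j, w) ∉ p).card

/-- The weight of a rook placement. -/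
def placementWeight {K : Type*} [Field K] (y q : K) (p : Finset (ℕ × ℕ)) : K :=
  ∏ x ∈ p, rookWeight y q p x

theorem qInt_succ {K : Type*} [Field K] (q : K) (h : ℕ) :
    qInt q (h + 1) = qInt q h + q ^ h := Finset.sum_range_succ _ _

/-- The number of larger elements runs once through `0, …, s.card - 1`. -/
theorem sum_pow_card_filter_lt {K : Type*} [Field K] (q : K) (s : Finset ℕ) :
    ∑ v ∈ s, q ^ (s.filter (v < ·)).card = qInt q s.card := by
  induction s using Finset.induction_on_min with
  | empty => simp [qInt]
  | insert a s ha ih =>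
    have hn : a ∉ s := fun h => lt_irrefl _ (ha a h)
    rw [Finset.sum_insert hn, Finset.card_insert_of_notMem hn, qInt_succ, ← ih, add_comm]
    congr 1
    · refine Finset.sum_congr rfl fun v hv => ?_
      rw [Finset.filter_insert, if_neg (ha v hv).not_gt]
    · rw [Finset.filter_insert, if_neg (lt_irrefl a), Finset.filter_true_of_mem ha]

/-- Old rooks inspect only rows below `m`, so their weights are unaffected; the new one sees the
free columns to its right. -/
theorem placementWeight_insert_row {K : Type*} [Field K] (y q : K) {m v : ℕ}
    {p : Finset (ℕ × ℕ)} (hp : p ∈ rookPlacements m m) (hv : v ∈ freeCols m p) :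
    placementWeight y q (insert (m, v) p) =
      q ^ ((freeCols m p).filter (v < ·)).card * placementWeight y q p := by
  have hb := (mem_rookPlacements.mp hp).1
  rw [mem_freeCols] at hv
  rw [placementWeight, Finset.prod_insert (hv.2 m)]
  congr 1
  · rw [rookWeight, if_neg (by simpa using hv.1.le)]
    congr 2
    ext w
    simp only [Finset.mem_filter, Finset.mem_Ioo, mem_freeCols, Finset.mem_insert, Prod.mk.injEq]
    grind
  · refine Finset.prod_congr rfl ?_
    rintro ⟨i, w⟩ hx
    have hi := hb i w hx
    simp only [rookWeight]
    congr 1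
    · congr 3
      ext j
      simp only [Finset.mem_filter, Finset.mem_Ioc, Finset.mem_insert, Prod.mk.injEq]
      grind
    · congr 2
      ext j
      simp only [Finset.mem_filter, Finset.mem_Ioo, Finset.mem_insert, Prod.mk.injEq]
      grind

/-- Old rooks inspect only columns below `m`. The new one counts the free rows after `i`, row `m`
included: this matches the weak inequality `j ≤ σ i` in `cr`. -/
theorem placementWeight_insert_col {K : Type*} [Field K] (y q : K) {m i : ℕ}
    {p : Finset (ℕ × ℕ)} (hp : p ∈ rookPlacements (m + 1) m)
    (hi : i ∈ (freeRows (m + 1) p).erase m) :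
    placementWeight y q (insert (i, m) p) =
      y * q ^ ((freeRows (m + 1) p).filter (i < ·)).card * placementWeight y q p := by
  have hb := (mem_rookPlacements.mp hp).1
  rw [Finset.mem_erase, mem_freeRows] at hi
  rw [placementWeight, Finset.prod_insert (hi.2.2 m)]
  congr 1
  · rw [rookWeight, if_pos (show i < m by omega)]
    congr 3
    ext w
    simp only [Finset.mem_filter, Finset.mem_Ioc, mem_freeRows, Finset.mem_insert, Prod.mk.injEq]
    grind
  · refine Finset.prod_congr rfl ?_
    rintro ⟨j, w⟩ hx
    have hj := hb j w hx
    simp only [rookWeight]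
    congr 1
    · congr 3
      ext j
      simp only [Finset.mem_filter, Finset.mem_Ioc, Finset.mem_insert, Prod.mk.injEq]
      grind
    · congr 2
      ext j
      simp only [Finset.mem_filter, Finset.mem_Ioo, Finset.mem_insert, Prod.mk.injEq]
      grind

/-- The total weight of the placements on the square board of size `m`, each weighted in addition
by the value of `g` at its number of free rows. -/
def placementSum {K : Type*} [Field K] (y q : K) (m : ℕ) (g : ℕ → K) : K :=
  ∑ p ∈ rookPlacements m m, placementWeight y q p * g (m - p.card)

theorem sum_insert_col {K : Type*} [Field K] (y q : K) {m : ℕ} {p : Finset (ℕ × ℕ)}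
    (hp : p ∈ rookPlacements (m + 1) m) (g : ℕ → K) :
    ∑ i ∈ (freeRows (m + 1) p).erase m,
        placementWeight y q (insert (i, m) p) * g (m + 1 - (insert (i, m) p).card) =
      y * (if m ∈ freeRows (m + 1) p then qInt q (freeRows (m + 1) p).card - 1
        else qInt q (freeRows (m + 1) p).card) * placementWeight y q p * g (m - p.card) := by
  have h1 : ∀ i ∈ (freeRows (m + 1) p).erase m,
      placementWeight y q (insert (i, m) p) * g (m + 1 - (insert (i, m) p).card) =
      q ^ ((freeRows (m + 1) p).filter (i < ·)).card *
        (y * placementWeight y q p * g (m - p.card)) := by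
    intro i hi
    have hn : (i, m) ∉ p := (mem_freeRows.mp (Finset.mem_of_mem_erase hi)).2 m
    rw [placementWeight_insert_col y q hp hi, Finset.card_insert_of_notMem hn,
      Nat.add_sub_add_right]
    ring
  rw [Finset.sum_congr rfl h1, ← Finset.sum_mul]
  have h2 : ∑ i ∈ (freeRows (m + 1) p).erase m,
      q ^ ((freeRows (m + 1) p).filter (i < ·)).card =
      if m ∈ freeRows (m + 1) p then qInt q (freeRows (m + 1) p).card - 1
        else qInt q (freeRows (m + 1) p).card := by
    split_ifs with hm
    -- Row `m` is the largest free row, so the forbidden diagonal cell accounts for the term `q ^ 0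
    -- = 1`.
    · rw [← sum_pow_card_filter_lt, ← Finset.add_sum_erase _ _ hm, Finset.filter_false_of_mem]
      · simp
      · intro j hj
        have := (mem_freeRows.mp hj).1
        omega
    · rw [Finset.erase_eq_of_notMem hm, sum_pow_card_filter_lt]
  rw [h2]
  ring

/-- Source of the factor `q` in the level step that fills only the column: the diagonal cell is
excluded. -/
theorem qInt_succ_sub_one {K : Type*} [Field K] (q : K) (h : ℕ) :
    qInt q (h + 1) - 1 = q * qInt q h := by
  rw [qInt, Finset.sum_range_succ', qInt, Finset.mul_sum]
  simp [pow_succ']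

/-- When `y * q = -1`, the two kinds of level steps cancel. -/
theorem placementSum_succ {K : Type*} [Field K] (y q : K) (hyq : y * q = -1) (m : ℕ)
    (g : ℕ → K) : placementSum y q (m + 1) g = placementSum y q m (dyckStep y q g) := by
  rw [placementSum, sum_rookPlacements_succ_right,
    Finset.sum_congr rfl fun p hp => by rw [sum_insert_col y q hp g],
    sum_rookPlacements_succ_left, placementSum]
  refine Finset.sum_congr rfl fun p hp => ?_
  have hb := (mem_rookPlacements.mp hp).1
  have hR := card_freeRows hp
  have hC := card_freeCols hp
  have hm : m ∈ freeRows (m + 1) p :=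
    mem_freeRows.mpr ⟨m.lt_add_one, fun v hv => lt_irrefl _ (hb m v hv).1⟩
  have hF : (freeRows (m + 1) p).card = (freeCols m p).card + 1 := by
    have : freeRows (m + 1) p = insert m (freeRows m p) := by
      ext i
      simp only [mem_freeRows, Finset.mem_insert]
      grind
    rw [this, Finset.card_insert_of_notMem (by simp [mem_freeRows])]
    omega
  have hE : (freeCols m p).erase m = freeCols m p :=
    Finset.erase_eq_of_notMem (by simp [mem_freeCols])
  rw [if_pos hm, hF, hE, qInt_succ_sub_one]
  set h := (freeCols m p).card with hh
  have hins : ∀ v ∈ freeCols m p,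
      placementWeight y q (insert (m, v) p) * g (m + 1 - (insert (m, v) p).card) +
        y * (if m ∈ freeRows (m + 1) (insert (m, v) p) then
            qInt q (freeRows (m + 1) (insert (m, v) p)).card - 1
          else qInt q (freeRows (m + 1) (insert (m, v) p)).card) *
          placementWeight y q (insert (m, v) p) * g (m - (insert (m, v) p).card) =
      q ^ ((freeCols m p).filter (v < ·)).card *
        (placementWeight y q p * (g h + y * qInt q h * g (h - 1))) := by
    intro v hv
    have hn : (m, v) ∉ p := (mem_freeCols.mp hv).2 m
    have hm' : m ∉ freeRows (m + 1) (insert (m, v) p) := by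
      rw [mem_freeRows]
      intro hx
      exact hx.2 v (Finset.mem_insert_self _ _)
    have hF' : freeRows (m + 1) (insert (m, v) p) = freeRows m p := by
      ext i
      simp only [mem_freeRows, Finset.mem_insert, Prod.mk.injEq]
      grind
    rw [if_neg hm', hF', placementWeight_insert_row y q hp hv, Finset.card_insert_of_notMem hn,
      show (freeRows m p).card = h by omega, show m + 1 - (p.card + 1) = h by omega,
      show m - (p.card + 1) = h - 1 by omega]
    ring
  rw [Finset.sum_congr rfl hins, ← Finset.sum_mul, sum_pow_card_filter_lt, ← hh,
    show m + 1 - p.card = h + 1 by omega, show m - p.card = h by omega, dyckStep]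
  -- The coefficient of `g h` is `(1 + y * q) * [h]_q`, which vanishes by `hyq`.
  linear_combination qInt q h * placementWeight y q p * g h * hyq

theorem placementSum_eq_iterate {K : Type*} [Field K] (y q : K) (hyq : y * q = -1) (m : ℕ) :
    ∀ g : ℕ → K, placementSum y q m g = (dyckStep y q)^[m] g 0 := by
  induction m with
  | zero =>
    intro g
    have : rookPlacements 0 0 = {∅} := by decide
    simp [placementSum, this, placementWeight]
  | succ m ih =>
    intro g
    rw [placementSum_succ y q hyq, ih, Function.iterate_succ_apply]

/-! ### Derangements as full placements -/

/-- The graph of a permutation of `Fin n`. -/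
def permGraph {n : ℕ} (σ : Equiv.Perm (Fin n)) : Finset (ℕ × ℕ) :=
  Finset.univ.image fun i : Fin n => ((i : ℕ), (σ i : ℕ))

theorem mem_permGraph {n : ℕ} {σ : Equiv.Perm (Fin n)} {i v : ℕ} :
    (i, v) ∈ permGraph σ ↔ ∃ j : Fin n, (j : ℕ) = i ∧ (σ j : ℕ) = v := by
  simp [permGraph]

theorem card_permGraph {n : ℕ} (σ : Equiv.Perm (Fin n)) : (permGraph σ).card = n := by
  rw [permGraph, Finset.card_image_of_injective, Finset.card_univ, Fintype.card_fin]
  intro i j h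
  exact Fin.ext (Prod.mk.inj h).1

theorem permGraph_injective {n : ℕ} :
    Function.Injective (permGraph : Equiv.Perm (Fin n) → Finset (ℕ × ℕ)) := by
  intro σ τ h
  ext i
  have hi : ((i : ℕ), (σ i : ℕ)) ∈ permGraph τ := h ▸ mem_permGraph.mpr ⟨i, rfl, rfl⟩
  obtain ⟨j, hj, hv⟩ := mem_permGraph.mp hi
  rw [← hv, Fin.ext hj]

theorem permGraph_mem_rookPlacements {n : ℕ} {σ : Equiv.Perm (Fin n)}
    (hσ : σ ∈ derangements (Fin n)) : permGraph σ ∈ rookPlacements n n := by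
  simp only [mem_rookPlacements, mem_permGraph]
  refine ⟨?_, ?_, ?_⟩
  · rintro _ _ ⟨j, rfl, rfl⟩
    exact ⟨j.2, (σ j).2, fun h => hσ j (Fin.ext h.symm)⟩
  · rintro _ _ _ ⟨j, rfl, rfl⟩ ⟨k, hk, rfl⟩
    rw [Fin.ext hk]
  · rintro _ _ _ ⟨j, rfl, rfl⟩ ⟨k, rfl, hk⟩
    rw [σ.injective (Fin.ext hk)]

theorem exists_permGraph_eq {n : ℕ} {p : Finset (ℕ × ℕ)} (hp : p ∈ rookPlacements n n)
    (hc : p.card = n) : ∃ σ ∈ derangements (Fin n), permGraph σ = p := by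
  have hR : freeRows n p = ∅ := by
    have := card_freeRows hp
    exact Finset.card_eq_zero.mp (by omega)
  obtain ⟨h1, h2, h3⟩ := mem_rookPlacements.mp hp
  have hex : ∀ i : Fin n, ∃ v : Fin n, ((i : ℕ), (v : ℕ)) ∈ p := by
    intro i
    by_contra! hi
    have : (i : ℕ) ∈ freeRows n p :=
      mem_freeRows.mpr ⟨i.2, fun v hv => hi ⟨v, (h1 _ _ hv).2.1⟩ hv⟩
    simp [hR] at this
  choose f hf using hex
  have hinj : Function.Injective f := fun i j hij =>
    Fin.ext (h3 i j (f i) (hf i) (hij ▸ hf j))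
  refine ⟨Equiv.ofBijective f (Finite.injective_iff_bijective.mp hinj),
    fun i hi => (h1 _ _ (hf i)).2.2 (congrArg Fin.val hi).symm, ?_⟩
  apply Finset.eq_of_subset_of_card_le
  · rintro ⟨i, v⟩ hx
    obtain ⟨j, rfl, rfl⟩ := mem_permGraph.mp hx
    exact hf j
  · rw [card_permGraph, hc]

/-- The sign of `σ i - i` decides which kind of crossing can start at `i`. Having no rook in row `j`
up to column `σ i` means `σ i < σ j`; below the diagonal, crossings are indexed by the column `σ j`
instead. -/
theorem rookWeight_permGraph {K : Type*} [Field K] (y q : K) {n : ℕ} {σ : Equiv.Perm (Fin n)}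
    (hσ : σ ∈ derangements (Fin n)) (i : Fin n) :
    rookWeight y q (permGraph σ) (i, σ i) = (if i ≤ σ i then y else 1) *
      q ^ (Finset.univ.filter fun j : Fin n =>
        (i < j ∧ j ≤ σ i ∧ σ i < σ j) ∨ (σ i < σ j ∧ σ j < i ∧ i < j)).card := by
  have hne : σ i ≠ i := hσ i
  rw [rookWeight]
  by_cases h : i < σ i
  · rw [if_pos (by simpa using h), if_pos h.le]
    congr 2
    symm
    refine Finset.card_bij (fun j _ => (j : ℕ)) ?_ (fun _ _ _ _ => Fin.ext) ?_
    · intro j hj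
      simp only [Finset.mem_filter, Finset.mem_univ, true_and, Finset.mem_Ioc,
        mem_permGraph] at hj ⊢
      refine ⟨by omega, ?_⟩
      rintro w hw ⟨k, hk, rfl⟩
      obtain rfl := Fin.ext hk
      omega
    · intro j hj
      simp only [Finset.mem_filter, Finset.mem_Ioc, mem_permGraph] at hj
      have hjn : j < n := by omega
      refine ⟨⟨j, hjn⟩, ?_, rfl⟩
      simp only [Finset.mem_filter, Finset.mem_univ, true_and]
      left
      refine ⟨hj.1.1, hj.1.2, ?_⟩
      by_contra hlt
      exact hj.2 (σ ⟨j, hjn⟩) (by simpa using hlt) ⟨⟨j, hjn⟩, rfl, rfl⟩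
  · rw [if_neg (by simpa using h), if_neg (by omega), one_mul]
    congr 1
    symm
    refine Finset.card_bij (fun j _ => (σ j : ℕ)) ?_
      (fun _ _ _ _ hjk => σ.injective (Fin.ext hjk)) ?_
    · intro j hj
      simp only [Finset.mem_filter, Finset.mem_univ, true_and, Finset.mem_Ioo,
        mem_permGraph] at hj ⊢
      refine ⟨by omega, ?_⟩
      rintro w hw ⟨k, rfl, hk⟩
      obtain rfl := σ.injective (Fin.ext hk)
      omega
    · intro w hw
      simp only [Finset.mem_filter, Finset.mem_Ioo, mem_permGraph] at hw
      have hwn : w < n := by omega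
      refine ⟨σ.symm ⟨w, hwn⟩, ?_, by simp⟩
      simp only [Finset.mem_filter, Finset.mem_univ, true_and, Equiv.apply_symm_apply]
      right
      refine ⟨hw.1.1, hw.1.2, ?_⟩
      by_contra hlt
      exact hw.2 (σ.symm ⟨w, hwn⟩) (by simpa using hlt) ⟨σ.symm ⟨w, hwn⟩, rfl, by simp⟩

theorem placementWeight_permGraph {K : Type*} [Field K] (y q : K) {n : ℕ}
    {σ : Equiv.Perm (Fin n)} (hσ : σ ∈ derangements (Fin n)) :
    placementWeight y q (permGraph σ) = y ^ wex σ * q ^ cr σ := by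
  rw [placementWeight, permGraph, Finset.prod_image fun i _ j _ h => Fin.ext (Prod.mk.inj h).1,
    ← permGraph, Finset.prod_congr rfl fun i _ => rookWeight_permGraph y q hσ i,
    Finset.prod_mul_distrib, Finset.prod_ite, Finset.prod_const, Finset.prod_const_one, mul_one,
    Finset.prod_pow_eq_pow_sum, wex, cr]
  congr 2
  simp only [Finset.card_filter]
  rw [← Finset.univ_product_univ, Finset.sum_product]

theorem placementSum_atZero {K : Type*} [Field K] (y q : K) (n : ℕ) :
    placementSum y q n (atZero K) =
      ∑ σ : derangements (Fin n),
        y ^ wex (σ : Equiv.Perm (Fin n)) * q ^ cr (σ : Equiv.Perm (Fin n)) := by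
  rw [placementSum, ← Finset.sum_filter_of_ne (p := fun p => p.card = n)]
  · symm
    refine Finset.sum_bij (fun σ _ => permGraph σ.1) ?_ ?_ ?_ ?_
    · intro σ _
      exact Finset.mem_filter.mpr ⟨permGraph_mem_rookPlacements σ.2, card_permGraph _⟩
    · intro σ _ τ _ h
      exact Subtype.ext (permGraph_injective h)
    · intro p hp
      obtain ⟨hp, hc⟩ := Finset.mem_filter.mp hp
      obtain ⟨σ, hσ, rfl⟩ := exists_permGraph_eq hp hc
      exact ⟨⟨σ, hσ⟩, Finset.mem_univ _, rfl⟩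
    · intro σ _
      rw [placementWeight_permGraph y q σ.2, card_permGraph]
      simp [atZero]
  -- Since `p.card ≤ n`, a vanishing truncated difference forces `p.card = n`.
  · intro p hp h
    have h0 : n - p.card = 0 := by
      by_contra hne
      simp [atZero, hne] at h
    have := card_freeRows hp
    omega

theorem theorem2 {K : Type*} [Field K] (q : K) (hq : q ≠ 0) (n : ℕ) :
    ∑ σ : derangements (Fin n),
        (-(1 / q)) ^ wex (σ : Equiv.Perm (Fin n)) * q ^ cr (σ : Equiv.Perm (Fin n)) =
      if Even n then (-(1 / q)) ^ (n / 2) * qSecant q (n / 2) else 0 := by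
  rw [← placementSum_atZero, placementSum_eq_iterate _ _ (by field_simp), dyckStep_iterate_zero]
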